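/- Write $(s)_t=\Gamma(s+t)/\Gamma(s)$ for the Pochhammer symbol, and let $F(a,b;c;z)$ denote the Gauss hypergeometric function, defined by its power series near $z=0$ and by analytic continuation to $\mathbb C\setminus[1,\infty)$. Let $\alpha_1,\alpha_2>0$ and let $\nu\in\mathbb C$ be such that neither $\alpha_2+\nu$ nor $\alpha_1-\nu$ is a nonpositive integer (in particular, every $\nu$ with $-\alpha_2<\operatorname{Re}\nu<\alpha_1$ is allowed). For $y_1,y_2>0$ put $z=\alpha_2y_2/(\alpha_1y_1)$ and $$\mathscr T_\nu(y_1,y_2,\alpha_1,\alpha_2)=\frac{1}{\alpha_1y_1}\left((\alpha_1-1)\,F(1,2-\alpha_1;\alpha_2;-z)-\frac{z^{\nu}}{(\alpha_1)_{-\nu-1}(\alpha_2)_{\nu}}\,F(1,2-\alpha_1+\nu;\alpha_2+\nu;-z)\right),$$ where $1/(\alpha_1)_{-\nu-1}=\Gamma(\alpha_1)/\Gamma(\alpha_1-1-\nu)$ is read as $0$ if $\nu=\alpha_1-1$. For $\alpha_1\ne1$ this is $$\mathscr T_\nu(y_1,y_2,\alpha_1,\alpha_2)=\frac{\alpha_1-1}{\alpha_1y_1}\left(F(1,2-\alpha_1;\alpha_2;-z)-\frac{z^{\nu}}{(\alpha_1-1)_{-\nu}(\alpha_2)_{\nu}}\,F(1,2-\alpha_1+\nu;\alpha_2+\nu;-z)\right).$$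 **Theorem (reflection formula).** For all $y_1,y_2>0$, $$\mathscr T_\nu(y_1,y_2,\alpha_1,\alpha_2)=-\mathscr T_{-\nu}(y_2,y_1,\alpha_2,\alpha_1).$$ Consequently, for $\kappa_1,\kappa_2>0$ and $n\in\mathbb N_0$ let $$(\mathsf E\mathscr T_\nu^n)(\kappa_1,\kappa_2,\alpha_1,\alpha_2)=\mathsf E\bigl[\mathscr T_\nu(Y_1,Y_2,\alpha_1,\alpha_2)^n\bigr],$$ where $Y_1,Y_2$ are independent and $Y_i$ has the gamma distribution with shape $\alpha_i$ and rate $\alpha_i/\kappa_i$. Then $(\mathsf E\mathscr T_\nu^n)(\kappa_1,\kappa_2,\alpha_1,\alpha_2)$ exists (that is, the $n$-th power is integrable) if and only if $(\mathsf E\mathscr T_{-\nu}^n)(\kappa_2,\kappa_1,\alpha_2,\alpha_1)$ exists, and in that case $$(\mathsf E\mathscr T_\nu^n)(\kappa_1,\kappa_2,\alpha_1,\alpha_2)=(-1)^n\,(\mathsf E\mathscr T_{-\nu}^n)(\kappa_2,\kappa_1,\alpha_2,\alpha_1).$$ -/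

import Mathlib

open MeasureTheory ProbabilityTheory Topology

namespace RecipDiff

/-- The Pochhammer symbol `(s)_t = Γ(s + t) / Γ(s)` with complex index `t`. -/
noncomputable def poch (s t : ℂ) : ℂ := Complex.Gamma (s + t) / Complex.Gamma s

/-- The generalized hypergeometric series
`∑ₖ (a₁)ₖ ⋯ (aₚ)ₖ / ((b₁)ₖ ⋯ (b_q)ₖ) · zᵏ / k!`. -/
noncomputable def hgSeries (a b : Multiset ℂ) (z : ℂ) : ℂ :=
  ∑' k : ℕ, (a.map (ascPochhammer ℂ k).eval).prod / (b.map (ascPochhammer ℂ k).eval).prod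
    * (z ^ k / (k.factorial : ℂ))

/-- The cut plane `|ph (1 - z)| < π`, that is `ℂ \ [1, ∞)`. -/
def cutPlane : Set ℂ := {z | 1 - z ∈ Complex.slitPlane}

/-- `f` is the analytic continuation to the cut plane of the hypergeometric series at the
origin. -/
def IsHGContinuation (a b : Multiset ℂ) (f : ℂ → ℂ) : Prop :=
  AnalyticOnNhd ℂ f cutPlane ∧ f =ᶠ[𝓝 0] hgSeries a b

open Classical in
/-- The generalized hypergeometric function for `p = q + 1` (principal branch), defined by
analytic continuation in `z` to the cut plane. -/
noncomputable def hypergeom (a b : Multiset ℂ) (z : ℂ) : ℂ :=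
  if h : ∃ f, IsHGContinuation a b f then h.choose z else 0

theorem isPreconnected_cutPlane : IsPreconnected cutPlane := by
  have h : cutPlane = (fun w : ℂ => 1 - w) '' Complex.slitPlane := by
    ext z
    constructor
    · intro hz
      exact ⟨1 - z, hz, by ring⟩
    · rintro ⟨w, hw, rfl⟩
      simpa [cutPlane] using hw
  rw [h]
  exact (Complex.starConvex_one_slitPlane.isPathConnected
    Complex.one_mem_slitPlane).isConnected.isPreconnected.image _ (by fun_prop)

/-- The continuation is unique on the cut plane, so `hypergeom` does not depend on a choice. -/
theorem IsHGContinuation.hypergeom_eq {a b : Multiset ℂ} {f : ℂ → ℂ}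
    (hf : IsHGContinuation a b f) {z : ℂ} (hz : z ∈ cutPlane) : hypergeom a b z = f z := by
  have h : ∃ f, IsHGContinuation a b f := ⟨f, hf⟩
  have h0 : (0 : ℂ) ∈ cutPlane := by simp [cutPlane]
  rw [hypergeom, dif_pos h]
  exact h.choose_spec.1.eqOn_of_preconnected_of_eventuallyEq hf.1 isPreconnected_cutPlane h0
    (h.choose_spec.2.trans hf.2.symm) hz

/-- For `p = 2`, `q = 1` the series is Mathlib's Gauss hypergeometric series. -/
theorem hgSeries_gauss (a b c z : ℂ) :
    hgSeries {a, b} {c} z = ordinaryHypergeometric a b c z := by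
  rw [hgSeries, ordinaryHypergeometric_eq_tsum]
  refine tsum_congr fun k => ?_
  simp only [Multiset.insert_eq_cons, Multiset.map_cons, Multiset.map_singleton,
    Multiset.prod_cons, Multiset.prod_singleton, smul_eq_mul]
  ring

/-- The sine-modulated incomplete hypergeometric function `𝓕(α, β; γ; z)_ν`. -/
noncomputable def sineModHyp (α β γ z ν : ℂ) : ℂ :=
  hypergeom {α, β} {γ} z
    - poch α ν * (-z) ^ ν / (poch 1 ν * poch (1 - β) (-ν) * poch γ ν)
      * hypergeom {1, α + ν, β + ν} {1 + ν, γ + ν} z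

/-- The estimator `𝒯_ν(y₁, y₂, α₁, α₂)`. With `z = α₂ y₂ / (α₁ y₁)` it is
`(α₁ - 1) / (α₁ y₁) · 𝓕(1, 2 - α₁; α₂; -z)_ν`, see `estimator_eq` and
`estimator_eq_sineModHyp` below. Here the factor `(α₁ - 1) / (α₁ - 1)_{-ν}` is written as
`1 / (α₁)_{-ν-1}` and the common parameters of the `₃F₂` are cancelled; this also gives the
value at the removable singularities `α₁ = 1` and `ν = -1, -2, …`. -/
noncomputable def estimator (ν : ℂ) (y₁ y₂ α₁ α₂ : ℝ) : ℂ :=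
  1 / (α₁ * y₁ : ℂ) *
    (((α₁ : ℂ) - 1) * hypergeom {1, 2 - (α₁ : ℂ)} {(α₂ : ℂ)} (-(α₂ * y₂ / (α₁ * y₁) : ℂ))
      - (α₂ * y₂ / (α₁ * y₁) : ℂ) ^ ν / (poch α₁ (-ν - 1) * poch α₂ ν)
        * hypergeom {1, 2 - (α₁ : ℂ) + ν} {(α₂ : ℂ) + ν} (-(α₂ * y₂ / (α₁ * y₁) : ℂ)))

theorem estimator_eq (ν : ℂ) (y₁ y₂ α₁ α₂ : ℝ) (hα₁ : α₁ ≠ 1) :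
    estimator ν y₁ y₂ α₁ α₂ = ((α₁ : ℂ) - 1) / (α₁ * y₁) *
      (hypergeom {1, 2 - (α₁ : ℂ)} {(α₂ : ℂ)} (-(α₂ * y₂ / (α₁ * y₁) : ℂ))
        - (α₂ * y₂ / (α₁ * y₁) : ℂ) ^ ν / (poch ((α₁ : ℂ) - 1) (-ν) * poch α₂ ν)
          * hypergeom {1, 2 - (α₁ : ℂ) + ν} {(α₂ : ℂ) + ν}
              (-(α₂ * y₂ / (α₁ * y₁) : ℂ))) := by
  have h : (α₁ : ℂ) - 1 ≠ 0 := by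
    rw [sub_ne_zero]
    exact_mod_cast hα₁
  have hΓ : Complex.Gamma (α₁ : ℂ) = ((α₁ : ℂ) - 1) * Complex.Gamma ((α₁ : ℂ) - 1) := by
    have := Complex.Gamma_add_one _ h
    rwa [sub_add_cancel] at this
  have hp : poch ((α₁ : ℂ) - 1) (-ν) = ((α₁ : ℂ) - 1) * poch α₁ (-ν - 1) := by
    rw [poch, poch, hΓ, show (α₁ : ℂ) - 1 + -ν = α₁ + (-ν - 1) by ring, mul_div_assoc',
      mul_div_mul_left _ _ h]
  have key : ∀ A B C D E p q : ℂ, A ≠ 0 →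
      1 / B * (A * C - D / (p * q) * E) = A / B * (C - D / (A * p * q) * E) := by
    intro A B C D E p q hA
    have : D / (A * p * q) = A⁻¹ * (D / (p * q)) := by
      simp only [div_eq_mul_inv, mul_inv]
      ring
    rw [this]
    calc 1 / B * (A * C - D / (p * q) * E)
        = 1 / B * (A * C - (A * A⁻¹) * (D / (p * q) * E)) := by rw [mul_inv_cancel₀ hA, one_mul]
      _ = A / B * (C - A⁻¹ * (D / (p * q)) * E) := by ring
  rw [hp, estimator]
  exact key _ _ _ _ _ _ _ h

theorem hypergeom_cancel {a b c d : ℂ} (hd : ∀ m : ℕ, d ≠ -(m : ℂ)) (z : ℂ) :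
    hypergeom {a, d, b} {d, c} z = hypergeom {a, b} {c} z := by
  have h : hgSeries {a, d, b} {d, c} = hgSeries {a, b} {c} := by
    funext w
    refine tsum_congr fun k => ?_
    have hk : (ascPochhammer ℂ k).eval d ≠ 0 := by
      rw [Ne, ascPochhammer_eval_eq_zero_iff]
      rintro ⟨m, -, hm⟩
      exact hd m (by rw [hm, neg_neg])
    simp only [Multiset.insert_eq_cons, Multiset.map_cons, Multiset.map_singleton,
      Multiset.prod_cons, Multiset.prod_singleton]
    congr 1
    rw [mul_left_comm, mul_div_mul_left _ _ hk]
  have h2 : IsHGContinuation {a, d, b} {d, c} = IsHGContinuation {a, b} {c} := by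
    funext f
    simp only [IsHGContinuation, h]
  unfold hypergeom
  rw [h2]

theorem estimator_eq_sineModHyp (ν : ℂ) (y₁ y₂ α₁ α₂ : ℝ) (hα₁ : α₁ ≠ 1)
    (hν : ∀ m : ℕ, 1 + ν ≠ -(m : ℂ)) :
    estimator ν y₁ y₂ α₁ α₂ = ((α₁ : ℂ) - 1) / (α₁ * y₁) *
      sineModHyp 1 (2 - (α₁ : ℂ)) α₂ (-(α₂ * y₂ / (α₁ * y₁) : ℂ)) ν := by
  have hp : poch 1 ν ≠ 0 := by
    rw [poch, Complex.Gamma_one, div_one]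
    exact Complex.Gamma_ne_zero hν
  rw [estimator_eq _ _ _ _ _ hα₁, sineModHyp, hypergeom_cancel hν, neg_neg,
    show (1 : ℂ) - (2 - (α₁ : ℂ)) = (α₁ : ℂ) - 1 by ring, mul_assoc (poch 1 ν),
    mul_div_mul_left _ _ hp]

/-- The joint law of independent `Y₁ ∼ 𝒢(α₁, α₁ / κ₁)` and `Y₂ ∼ 𝒢(α₂, α₂ / κ₂)`
(shape, rate), so that `Yᵢ` has mean `κᵢ`. -/
noncomputable def jointLaw (κ₁ κ₂ α₁ α₂ : ℝ) : Measure (ℝ × ℝ) :=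
  (gammaMeasure α₁ (α₁ / κ₁)).prod (gammaMeasure α₂ (α₂ / κ₂))

/-- The `n`-th power of the estimator has a finite expected value. -/
def HasMoment (n : ℕ) (ν : ℂ) (κ₁ κ₂ α₁ α₂ : ℝ) : Prop :=
  Integrable (fun y : ℝ × ℝ => estimator ν y.1 y.2 α₁ α₂ ^ n) (jointLaw κ₁ κ₂ α₁ α₂)

/-- The `n`-th moment `E 𝒯_ν(Y₁, Y₂, α₁, α₂)ⁿ` as a function of `(κ₁, κ₂, α₁, α₂)`. -/
noncomputable def moment (n : ℕ) (ν : ℂ) (κ₁ κ₂ α₁ α₂ : ℝ) : ℂ :=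
  ∫ y : ℝ × ℝ, estimator ν y.1 y.2 α₁ α₂ ^ n ∂(jointLaw κ₁ κ₂ α₁ α₂)

end RecipDiff

namespace RecipDiff

/-! With `regHyp a b z` $=F(1,2-a;b;-z)/(\Gamma(a-1)\Gamma(b))$, everything rests on
`connectionFormula`:
$$\mathrm{regHyp}(a,b,z)+z^{-1}\,\mathrm{regHyp}(b,a,1/z)=\frac{z^{1-b}(1+z)^{a+b-3}}{\Gamma(a+b-2)}.$$
Replacing $(a,b)$ by $(a-\nu,b+\nu)$ multiplies the right side by $z^{-\nu}$ only. By
`estimator_eq_regHyp` the estimator is a multiple of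
$\mathrm{regHyp}(\alpha_1,\alpha_2,z)-z^\nu\,\mathrm{regHyp}(\alpha_1-\nu,\alpha_2+\nu,z)$, so in
the sum with its mirror image the right sides cancel; the prefactors match because
$\alpha_1y_1z=\alpha_2y_2$.

For $\operatorname{Re}a,\operatorname{Re}b>2$, Euler's integral turns the two terms on the left into
complementary pieces of one Beta integral (`betaIntegral_eq_add_eulerIntegral`). Contiguous
relations show that both sides obey the same recursion under $b\mapsto b+1$
(`one_add_mul_regHyp_add`), which with the symmetry in $a,b$ removes the restriction.

The moment statement follows since $Y_1,Y_2>0$ almost surely and swapping coordinates exchanges the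
two joint laws. -/

theorem isOpen_cutPlane : IsOpen cutPlane :=
  Complex.isOpen_slitPlane.preimage (by fun_prop : Continuous fun z : ℂ => 1 - z)

theorem zero_mem_cutPlane : (0 : ℂ) ∈ cutPlane := by simp [cutPlane]

theorem one_sub_ne_zero_of_mem_cutPlane {w : ℂ} (hw : w ∈ cutPlane) : 1 - w ≠ 0 :=
  Complex.slitPlane_ne_zero hw

theorem neg_ofReal_mem_cutPlane {x : ℝ} (hx : 0 < x) : -(x : ℂ) ∈ cutPlane := by
  have : (1 : ℂ) - -(x : ℂ) = ((1 + x : ℝ) : ℂ) := by push_cast; ring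
  rw [cutPlane, Set.mem_ofPred_eq, this, Complex.ofReal_mem_slitPlane]
  linarith

/-- $1-tw=(1-t)\cdot 1+t(1-w)$, and the slit plane is star-shaped about $1$. This keeps Euler's
integrand on the principal branch. -/
theorem one_sub_mul_mem_slitPlane {w : ℂ} (hw : w ∈ cutPlane) {t : ℝ}
    (ht : t ∈ Set.Icc (0 : ℝ) 1) : 1 - (t : ℂ) * w ∈ Complex.slitPlane := by
  have h := Complex.starConvex_one_slitPlane hw (sub_nonneg.2 ht.2) ht.1 (by ring)
  convert h using 1
  simp only [Complex.real_smul]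
  push_cast
  ring

/-! ### The series `∑ₖ (β)ₖ / (γ)ₖ wᵏ` -/

theorem ascPochhammer_eval_ne_zero {γ : ℂ} (hγ : ∀ m : ℕ, γ ≠ -(m : ℂ)) (k : ℕ) :
    (ascPochhammer ℂ k).eval γ ≠ 0 := by
  rw [Ne, ascPochhammer_eval_eq_zero_iff]
  rintro ⟨m, -, hm⟩
  exact hγ m (by rw [hm, neg_neg])

theorem ascPochhammer_succ_eval_left (k : ℕ) (s : ℂ) :
    (ascPochhammer ℂ (k + 1)).eval s = s * (ascPochhammer ℂ k).eval (s + 1) := by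
  simp [ascPochhammer_succ_left]

theorem hgSeries_one (β γ w : ℂ) :
    hgSeries {1, β} {γ} w =
      ∑' k : ℕ, (ascPochhammer ℂ k).eval β / (ascPochhammer ℂ k).eval γ * w ^ k := by
  refine tsum_congr fun k => ?_
  have : (k.factorial : ℂ) ≠ 0 := by exact_mod_cast k.factorial_ne_zero
  simp only [Multiset.insert_eq_cons, Multiset.map_cons, Multiset.map_singleton,
    Multiset.prod_cons, Multiset.prod_singleton, ascPochhammer_eval_one]
  field_simp

theorem summable_hgSeries_one (β γ : ℂ) {w : ℂ} (hw : ‖w‖ < 1) :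
    Summable fun k : ℕ =>
      (ascPochhammer ℂ k).eval β / (ascPochhammer ℂ k).eval γ * w ^ k := by
  obtain ⟨r, hwr, hr⟩ := exists_between hw
  have hlim : Filter.Tendsto (fun k : ℕ => ‖(β + k) / (γ + k) * w‖) Filter.atTop (𝓝 ‖w‖) := by
    have h1 : Filter.Tendsto (fun k : ℕ => (β + k) / (γ + k)) Filter.atTop (𝓝 1) := by
      have h := tendsto_add_mul_div_add_mul_atTop_nhds β γ (1 : ℂ) one_ne_zero
      simpa using h
    simpa using (h1.mul_const w).norm
  refine summable_of_ratio_norm_eventually_le hr ?_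
  filter_upwards [hlim.eventually_lt_const hwr] with k hk
  rw [ascPochhammer_succ_eval, ascPochhammer_succ_eval, mul_div_mul_comm, pow_succ,
    show ∀ x y z u : ℂ, x * y * (z * u) = y * u * (x * z) by intros; ring, norm_mul]
  exact mul_le_mul_of_nonneg_right hk.le (norm_nonneg _)

/-- Index shift with $(s)_{k+1}=s\,(s+1)_k$. The identity is termwise and survives zero denominators
through `x / 0 = 0`, so $\gamma$ is unrestricted. -/
theorem hgSeries_one_eq_raise {β γ w : ℂ} (hw : ‖w‖ < 1) :
    hgSeries {1, β} {γ} w = 1 + β / γ * w * hgSeries {1, β + 1} {γ + 1} w := by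
  rw [hgSeries_one, hgSeries_one, (summable_hgSeries_one β γ hw).tsum_eq_zero_add, ← tsum_mul_left]
  congr 1
  · simp
  · refine tsum_congr fun k => ?_
    rw [ascPochhammer_succ_eval_left, ascPochhammer_succ_eval_left, mul_div_mul_comm, pow_succ]
    ring

/-- Compare coefficients of $w^{k+1}$: $\frac{\beta+k}{\gamma+k}-1=\frac{\beta-\gamma}{\gamma+k}$
and $(\gamma)_k(\gamma+k)=\gamma\,(\gamma+1)_k$. -/
theorem one_sub_mul_hgSeries_one {β γ w : ℂ} (hγ : ∀ m : ℕ, γ ≠ -(m : ℂ)) (hw : ‖w‖ < 1) :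
    (1 - w) * hgSeries {1, β} {γ} w = 1 + (β - γ) / γ * w * hgSeries {1, β} {γ + 1} w := by
  have hs := summable_hgSeries_one β γ hw
  have h : hgSeries {1, β} {γ} w = 1 + ∑' k : ℕ,
      (ascPochhammer ℂ (k + 1)).eval β / (ascPochhammer ℂ (k + 1)).eval γ * w ^ (k + 1) := by
    rw [hgSeries_one, hs.tsum_eq_zero_add]
    simp
  rw [sub_mul, one_mul]
  nth_rewrite 1 [h]
  rw [hgSeries_one, hgSeries_one, add_sub_assoc, ← tsum_mul_left, ← tsum_mul_left,
    ← ((summable_nat_add_iff 1).2 hs).tsum_sub (hs.mul_left w)]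
  congr 1
  refine tsum_congr fun k => ?_
  have h0 : γ ≠ 0 := by simpa using hγ 0
  have h1 := ascPochhammer_eval_ne_zero hγ k
  have h2 : γ + k ≠ 0 := fun h => hγ k (eq_neg_of_add_eq_zero_left h)
  have h3 : (ascPochhammer ℂ k).eval (γ + 1) = (ascPochhammer ℂ k).eval γ * (γ + k) / γ := by
    rw [eq_div_iff h0, ← ascPochhammer_succ_eval, ascPochhammer_succ_eval_left, mul_comm]
  rw [h3, ascPochhammer_succ_eval, ascPochhammer_succ_eval]
  field_simp
  ring

/-! ### Euler's integral -/

/-- Euler's integral for `F(1, β; γ; w)`. -/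
noncomputable def eulerIntegral (β γ w : ℂ) : ℂ :=
  (γ - 1) * ∫ t in (0 : ℝ)..1, (1 - (t : ℂ)) ^ (γ - 2) * (1 - (t : ℂ) * w) ^ (-β)

theorem continuousOn_one_sub_cpow {s : ℂ} (hs : 0 < s.re) :
    ContinuousOn (fun t : ℝ => (1 - (t : ℂ)) ^ s) (Set.Icc 0 1) := by
  intro t ht
  refine ContinuousAt.continuousWithinAt ?_
  refine (Complex.continuousAt_cpow_const_of_re_pos (Or.inl ?_) hs).comp
    (f := fun t : ℝ => 1 - (t : ℂ)) (by fun_prop)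
  simpa using ht.2

theorem continuousOn_one_sub_mul_cpow (s : ℂ) :
    ContinuousOn (fun p : ℂ × ℝ => (1 - (p.2 : ℂ) * p.1) ^ s) (cutPlane ×ˢ Set.Icc 0 1) := by
  intro p hp
  refine ContinuousAt.continuousWithinAt ?_
  exact ContinuousAt.cpow (by fun_prop) (by fun_prop) (one_sub_mul_mem_slitPlane hp.1 hp.2)

theorem differentiableOn_eulerIntegral {β γ : ℂ} (hγ : 2 < γ.re) :
    DifferentiableOn ℂ (eulerIntegral β γ) cutPlane := by
  intro w₀ hw₀
  obtain ⟨r, hr, hball⟩ := Metric.nhds_basis_closedBall.mem_iff.1 (isOpen_cutPlane.mem_nhds hw₀)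
  -- Convergence would only need $\operatorname{Re}\gamma>1$; the stronger bound makes the kernel
  -- continuous up to $t=1$, so compactness supplies a constant dominating bound.
  have hs : 0 < (γ - 2).re := by simpa using hγ
  have hker : ∀ c : ℂ, ContinuousOn
      (fun p : ℂ × ℝ => (1 - (p.2 : ℂ)) ^ (γ - 2) * (1 - (p.2 : ℂ) * p.1) ^ c)
      (cutPlane ×ˢ Set.Icc 0 1) := fun c =>
    ((continuousOn_one_sub_cpow hs).comp continuousOn_snd fun p hp => hp.2).mul
      (continuousOn_one_sub_mul_cpow c)
  have hker' : ContinuousOn (fun p : ℂ × ℝ => (1 - (p.2 : ℂ)) ^ (γ - 2) *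
      (β * p.2 * (1 - (p.2 : ℂ) * p.1) ^ (-β - 1))) (cutPlane ×ˢ Set.Icc 0 1) := by
    refine ((hker (-β - 1)).mul (by fun_prop :
      ContinuousOn (fun p : ℂ × ℝ => β * (p.2 : ℂ)) _)).congr fun p _ => ?_
    simp only [Pi.mul_apply]
    ring
  have hslice : ∀ {g : ℂ × ℝ → ℂ}, ContinuousOn g (cutPlane ×ˢ Set.Icc 0 1) → ∀ w ∈ cutPlane,
      ContinuousOn (fun t : ℝ => g (w, t)) (Set.Icc 0 1) := fun hg w hw =>
    hg.comp (by fun_prop) fun t ht => ⟨hw, ht⟩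
  have hmeas : ∀ {f : ℝ → ℂ}, ContinuousOn f (Set.Icc 0 1) →
      AEStronglyMeasurable f (volume.restrict (Set.uIoc 0 1)) := fun hf => by
    rw [Set.uIoc_of_le zero_le_one]
    exact (hf.mono Set.Ioc_subset_Icc_self).aestronglyMeasurable measurableSet_Ioc
  obtain ⟨C, hC⟩ := ((isCompact_closedBall w₀ r).prod (isCompact_Icc (a := (0 : ℝ)) (b := 1))
    ).exists_bound_of_continuousOn (hker'.mono (Set.prod_mono hball subset_rfl))
  have key := intervalIntegral.hasDerivAt_integral_of_dominated_loc_of_deriv_le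
    (F := fun (w : ℂ) (t : ℝ) => (1 - (t : ℂ)) ^ (γ - 2) * (1 - (t : ℂ) * w) ^ (-β))
    (F' := fun (w : ℂ) (t : ℝ) => (1 - (t : ℂ)) ^ (γ - 2) *
      (β * t * (1 - (t : ℂ) * w) ^ (-β - 1)))
    (x₀ := w₀) (s := Metric.closedBall w₀ r) (μ := volume) (a := 0) (b := 1)
    (bound := fun _ => C) (Metric.closedBall_mem_nhds w₀ hr) ?_ ?_ ?_ ?_ ?_ ?_
  · exact (key.2.differentiableAt.const_mul (γ - 1)).differentiableWithinAt
  · filter_upwards [isOpen_cutPlane.mem_nhds hw₀] with w hw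
    exact hmeas (hslice (hker (-β)) w hw)
  · exact (hslice (hker (-β)) w₀ hw₀).intervalIntegrable_of_Icc zero_le_one
  · exact hmeas (hslice hker' w₀ hw₀)
  · refine Filter.Eventually.of_forall fun t ht w hw => ?_
    rw [Set.uIoc_of_le zero_le_one] at ht
    exact hC (w, t) ⟨hw, Set.Ioc_subset_Icc_self ht⟩
  · exact intervalIntegrable_const
  · refine Filter.Eventually.of_forall fun t ht w hw => ?_
    rw [Set.uIoc_of_le zero_le_one] at ht
    have h1 : HasDerivAt (fun w : ℂ => 1 - (t : ℂ) * w) (-t) w := by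
      simpa using ((hasDerivAt_id w).const_mul (t : ℂ)).const_sub 1
    have h2 := (h1.cpow_const (c := -β)
      (one_sub_mul_mem_slitPlane (hball hw) (Set.Ioc_subset_Icc_self ht))).const_mul
        ((1 - (t : ℂ)) ^ (γ - 2))
    refine h2.congr_deriv ?_
    ring

theorem hasSum_one_sub_cpow_neg (β : ℂ) {x : ℂ} (hx : ‖x‖ < 1) :
    HasSum (fun k : ℕ => (ascPochhammer ℂ k).eval β / k.factorial * x ^ k) ((1 - x) ^ (-β)) := by
  have h := (Complex.one_div_one_sub_cpow_hasFPowerSeriesOnBall_zero β).hasSum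
    (y := x) (by simpa [enorm_eq_nnnorm, ← NNReal.coe_lt_coe] using hx)
  rw [zero_add, one_div, ← Complex.cpow_neg] at h
  refine h.congr_fun fun k => ?_
  rw [FormalMultilinearSeries.ofScalars_apply_eq, ← Ring.multichoose_eq, smul_eq_mul]
  congr 1
  have hk : (k.factorial : ℂ) ≠ 0 := by exact_mod_cast k.factorial_ne_zero
  rw [div_eq_iff hk, ← Polynomial.ascPochhammer_smeval_eq_eval,
    ← Ring.factorial_nsmul_multichoose_eq_ascPochhammer, nsmul_eq_mul, mul_comm]

theorem integral_pow_mul_one_sub_cpow {γ : ℂ} (hγ : 2 < γ.re) (k : ℕ) :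
    (γ - 1) * ∫ t in (0 : ℝ)..1, (t : ℂ) ^ k * (1 - (t : ℂ)) ^ (γ - 2) =
      k.factorial / (ascPochhammer ℂ k).eval γ := by
  have hre : 0 < (γ - 1).re := by simp; linarith
  have h0 : γ - 1 ≠ 0 := fun h => by simp [h] at hre
  have hb : ∫ t in (0 : ℝ)..1, (t : ℂ) ^ k * (1 - (t : ℂ)) ^ (γ - 2) =
      Complex.betaIntegral (k + 1) (γ - 1) := by
    rw [Complex.betaIntegral]
    congr 1 with t
    rw [add_sub_cancel_right, Complex.cpow_natCast, show γ - 1 - 1 = γ - 2 by ring]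
  -- The Beta value has denominator $(\gamma-1)_{k+1}$; its first factor cancels the prefactor
  -- $\gamma-1$.
  have hp : ∏ j ∈ Finset.range (k + 1), (γ - 1 + j) =
      (γ - 1) * (ascPochhammer ℂ k).eval γ := by
    have h := ascPochhammer_succ_eval_left k (γ - 1)
    rw [sub_add_cancel] at h
    rw [← h]
    generalize γ - 1 = s
    induction k + 1 with
    | zero => simp
    | succ n ih => rw [Finset.prod_range_succ, ih, ascPochhammer_succ_eval]
  rw [hb, Complex.betaIntegral_symm, Complex.betaIntegral_eval_nat_add_one_right hre, hp,
    mul_div_assoc', mul_div_mul_left _ _ h0]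

/-- Expand $(1-tw)^{-\beta}$ binomially and integrate termwise; the factors in $t$ are bounded by
$1$, so the binomial series at $w$ dominates. -/
theorem eulerIntegral_eq_hgSeries {β γ w : ℂ} (hγ : 2 < γ.re) (hw : ‖w‖ < 1) :
    eulerIntegral β γ w = hgSeries {1, β} {γ} w := by
  have hs : 0 < (γ - 2).re := by simpa using hγ
  set c : ℕ → ℂ := fun k => (ascPochhammer ℂ k).eval β / k.factorial with hc
  have hsum := intervalIntegral.hasSum_integral_of_dominated_convergence (μ := volume)
    (a := 0) (b := 1)
    (F := fun (k : ℕ) (t : ℝ) => c k * w ^ k * ((t : ℂ) ^ k * (1 - (t : ℂ)) ^ (γ - 2)))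
    (f := fun t : ℝ => (1 - (t : ℂ)) ^ (γ - 2) * (1 - (t : ℂ) * w) ^ (-β))
    (fun k _ => ‖c k * w ^ k‖) ?_ ?_ ?_ ?_ ?_
  · rw [eulerIntegral, hgSeries_one, ← (hsum.mul_left (γ - 1)).tsum_eq]
    refine tsum_congr fun k => ?_
    have hk : (k.factorial : ℂ) ≠ 0 := by exact_mod_cast k.factorial_ne_zero
    rw [intervalIntegral.integral_const_mul, mul_left_comm, integral_pow_mul_one_sub_cpow hγ, hc]
    field_simp
  · intro k
    rw [Set.uIoc_of_le zero_le_one]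
    refine ContinuousOn.aestronglyMeasurable ?_ measurableSet_Ioc
    have := (continuousOn_one_sub_cpow hs).mono Set.Ioc_subset_Icc_self
    fun_prop
  · intro k
    refine Filter.Eventually.of_forall fun t ht => ?_
    rw [Set.uIoc_of_le zero_le_one] at ht
    have h1 : ‖(t : ℂ) ^ k‖ ≤ 1 := by
      rw [norm_pow, Complex.norm_real, Real.norm_of_nonneg ht.1.le]
      exact pow_le_one₀ ht.1.le ht.2
    have h2 : ‖(1 - (t : ℂ)) ^ (γ - 2)‖ ≤ 1 := by
      have : (1 - (t : ℂ)) = ((1 - t : ℝ) : ℂ) := by push_cast; rfl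
      rw [this, Complex.norm_cpow_eq_rpow_re_of_nonneg (by linarith [ht.2]) hs.ne']
      exact Real.rpow_le_one (by linarith [ht.2]) (by linarith [ht.1]) hs.le
    rw [norm_mul, norm_mul ((t : ℂ) ^ k)]
    exact mul_le_of_le_one_right (norm_nonneg _) (mul_le_one₀ h1 (norm_nonneg _) h2)
  · refine Filter.Eventually.of_forall fun t _ => ?_
    exact (hasSum_one_sub_cpow_neg β hw).summable.norm
  · exact intervalIntegrable_const
  · refine Filter.Eventually.of_forall fun t ht => ?_
    rw [Set.uIoc_of_le zero_le_one] at ht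
    have htw : ‖(t : ℂ) * w‖ < 1 := by
      rw [norm_mul, Complex.norm_real, Real.norm_of_nonneg ht.1.le]
      exact (mul_le_of_le_one_left (norm_nonneg _) ht.2).trans_lt hw
    refine ((hasSum_one_sub_cpow_neg β htw).mul_left ((1 - (t : ℂ)) ^ (γ - 2))).congr_fun ?_
    intro k
    rw [mul_pow]
    ring

/-! ### Continuation of `F(1, β; γ; w)` and contiguous relations -/

theorem eventually_norm_lt_one : ∀ᶠ w : ℂ in 𝓝 0, ‖w‖ < 1 := by
  filter_upwards [Metric.ball_mem_nhds (0 : ℂ) one_pos] with w hw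
  simpa using hw

theorem isHGContinuation_eulerIntegral {β γ : ℂ} (hγ : 2 < γ.re) :
    IsHGContinuation {1, β} {γ} (eulerIntegral β γ) :=
  ⟨(differentiableOn_eulerIntegral hγ).analyticOnNhd isOpen_cutPlane,
    eventually_norm_lt_one.mono fun _ hw => eulerIntegral_eq_hgSeries hγ hw⟩

theorem IsHGContinuation.of_raise {β γ : ℂ} {f : ℂ → ℂ}
    (hf : IsHGContinuation {1, β + 1} {γ + 1} f) :
    IsHGContinuation {1, β} {γ} fun w => 1 + β / γ * w * f w := by
  refine ⟨fun w hw => ?_, ?_⟩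
  · have := hf.1 w hw
    fun_prop
  · filter_upwards [eventually_norm_lt_one, hf.2] with w hw hfw
    rw [hgSeries_one_eq_raise hw, hfw]

theorem IsHGContinuation.of_raise_right {β γ : ℂ} (hγ : ∀ m : ℕ, γ ≠ -(m : ℂ)) {f : ℂ → ℂ}
    (hf : IsHGContinuation {1, β} {γ + 1} f) :
    IsHGContinuation {1, β} {γ} fun w => (1 + (β - γ) / γ * w * f w) / (1 - w) := by
  refine ⟨fun w hw => ?_, ?_⟩
  · have := hf.1 w hw
    have h := one_sub_ne_zero_of_mem_cutPlane hw
    fun_prop (disch := assumption)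
  · filter_upwards [eventually_norm_lt_one, hf.2, isOpen_cutPlane.mem_nhds zero_mem_cutPlane]
      with w hw hfw hcut
    rw [div_eq_iff (one_sub_ne_zero_of_mem_cutPlane hcut), mul_comm (hgSeries _ _ _),
      one_sub_mul_hgSeries_one hγ hw, hfw]

theorem exists_isHGContinuation_one (β γ : ℂ) : ∃ f, IsHGContinuation {1, β} {γ} f := by
  -- $n$ unit steps bring $\operatorname{Re}\gamma$ beyond $2$, where Euler's integral applies.
  obtain ⟨n, hn⟩ := exists_nat_gt (2 - γ.re)
  induction n generalizing β γ with
  | zero => exact ⟨_, isHGContinuation_eulerIntegral (by simpa using hn)⟩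
  | succ n ih =>
    obtain ⟨f, hf⟩ := ih (β + 1) (γ + 1) (by push_cast at hn; simp; linarith)
    exact ⟨_, hf.of_raise⟩

theorem isHGContinuation_hypergeom_one (β γ : ℂ) :
    IsHGContinuation {1, β} {γ} (hypergeom {1, β} {γ}) := by
  have h := exists_isHGContinuation_one β γ
  have : hypergeom {1, β} {γ} = h.choose := by
    funext z
    rw [hypergeom, dif_pos h]
  rw [this]
  exact h.choose_spec

theorem hypergeom_one_eq_eulerIntegral {β γ w : ℂ} (hγ : 2 < γ.re) (hw : w ∈ cutPlane) :
    hypergeom {1, β} {γ} w = eulerIntegral β γ w :=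
  (isHGContinuation_eulerIntegral hγ).hypergeom_eq hw

theorem hypergeom_one_eq_raise {β γ w : ℂ} (hw : w ∈ cutPlane) :
    hypergeom {1, β} {γ} w = 1 + β / γ * w * hypergeom {1, β + 1} {γ + 1} w :=
  (isHGContinuation_hypergeom_one (β + 1) (γ + 1)).of_raise.hypergeom_eq hw

theorem one_sub_mul_hypergeom_one {β γ w : ℂ} (hγ : ∀ m : ℕ, γ ≠ -(m : ℂ)) (hw : w ∈ cutPlane) :
    (1 - w) * hypergeom {1, β} {γ} w = 1 + (β - γ) / γ * w * hypergeom {1, β} {γ + 1} w := by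
  rw [((isHGContinuation_hypergeom_one β (γ + 1)).of_raise_right hγ).hypergeom_eq hw,
    mul_div_cancel₀ _ (one_sub_ne_zero_of_mem_cutPlane hw)]

/-! ### The connection formula between `z` and `1 / z` -/

theorem ofReal_cpow_eq_exp {x : ℝ} (hx : 0 < x) (s : ℂ) :
    (x : ℂ) ^ s = Complex.exp (Real.log x * s) := by
  rw [Complex.cpow_def_of_ne_zero (by exact_mod_cast hx.ne'), Complex.ofReal_log hx.le]

/-- Substitute $p=c(1-t)$ with $c=z/(1+z)$, so that $1-p=(1+tz)/(1+z)$: the result is an incomplete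
Beta integral. -/
theorem eulerIntegral_two_sub_neg (a b : ℂ) {z : ℝ} (hz : 0 < z) :
    (z : ℂ) ^ (b - 1) * ((1 + z : ℝ) : ℂ) ^ (3 - a - b) * eulerIntegral (2 - a) b (-z) =
      (b - 1) * ∫ p in (0 : ℝ)..(z / (1 + z)), (p : ℂ) ^ (b - 2) * (1 - (p : ℂ)) ^ (a - 2) := by
  have hq : 0 < 1 + z := by linarith
  set c : ℝ := z / (1 + z) with hc
  have hc0 : 0 < c := div_pos hz hq
  have hsub : (c : ℂ) * ∫ t in (0 : ℝ)..1,
      ((c - c * t : ℝ) : ℂ) ^ (b - 2) * (1 - ((c - c * t : ℝ) : ℂ)) ^ (a - 2) =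
      ∫ p in (c - c * 1)..(c - c * 0), (p : ℂ) ^ (b - 2) * (1 - (p : ℂ)) ^ (a - 2) := by
    rw [← Complex.real_smul]
    exact intervalIntegral.smul_integral_comp_sub_mul
      (fun p : ℝ => (p : ℂ) ^ (b - 2) * (1 - (p : ℂ)) ^ (a - 2)) c c
  rw [mul_one, sub_self, mul_zero, sub_zero] at hsub
  rw [← hsub, eulerIntegral, ← intervalIntegral.integral_const_mul (c : ℂ), mul_left_comm,
    ← intervalIntegral.integral_const_mul (_ * _ : ℂ)]
  congr 1
  refine intervalIntegral.integral_congr_ae ?_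
  -- At $t=1$ the base $1-t$ vanishes and its power is not `exp` of a logarithm; elsewhere both
  -- integrands become a single exponential.
  have hne : ∀ᵐ t : ℝ, t ≠ 1 := by simp [ae_iff]
  filter_upwards [hne] with t ht1 ht
  rw [Set.uIoc_of_le zero_le_one] at ht
  have h1 : 0 < 1 - t := sub_pos.2 (lt_of_le_of_ne ht.2 ht1)
  have h2 : 0 < 1 + t * z := by nlinarith [ht.1]
  have e1 : (1 : ℂ) - t = ((1 - t : ℝ) : ℂ) := by push_cast; rfl
  have e2 : (1 : ℂ) - t * -(z : ℂ) = ((1 + t * z : ℝ) : ℂ) := by push_cast; ring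
  have e3 : c - c * t = c * (1 - t) := by ring
  have e4 : (1 : ℂ) - ((c * (1 - t) : ℝ) : ℂ) = (((1 + t * z) / (1 + z) : ℝ) : ℂ) := by
    rw [← Complex.ofReal_one, ← Complex.ofReal_sub, hc]
    congr 1
    field_simp
    ring
  have e5 : (c : ℂ) = Complex.exp (Real.log c) := by
    rw [← Complex.ofReal_exp, Real.exp_log hc0]
  rw [e1, e2, e3, e4]
  nth_rewrite 1 [e5]
  rw [ofReal_cpow_eq_exp hz, ofReal_cpow_eq_exp hq, ofReal_cpow_eq_exp h1, ofReal_cpow_eq_exp h2,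
    ofReal_cpow_eq_exp (mul_pos hc0 h1), ofReal_cpow_eq_exp (div_pos h2 hq),
    Real.log_mul hc0.ne' h1.ne', Real.log_div h2.ne' hq.ne', hc, Real.log_div hz.ne' hq.ne']
  simp only [← Complex.exp_add]
  congr 1
  push_cast
  ring

/-- The first Euler integral covers $[0,c]$ with $c=z/(1+z)$. The companion at $1/z$ has endpoint
$1-c$, and $p\mapsto1-p$ carries it to $[c,1]$. -/
theorem betaIntegral_eq_add_eulerIntegral {a b : ℂ} (ha : 2 < a.re) (hb : 2 < b.re) {z : ℝ}
    (hz : 0 < z) :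
    (a - 1) * (b - 1) * Complex.betaIntegral (b - 1) (a - 1) =
      (z : ℂ) ^ (b - 1) * ((1 + z : ℝ) : ℂ) ^ (3 - a - b) *
        ((a - 1) * eulerIntegral (2 - a) b (-z) +
          (z : ℂ)⁻¹ * ((b - 1) * eulerIntegral (2 - b) a (-((z⁻¹ : ℝ) : ℂ)))) := by
  have hq : 0 < 1 + z := by linarith
  have hz' : 0 < z⁻¹ := inv_pos.2 hz
  have h1 := eulerIntegral_two_sub_neg a b hz
  have h2 := eulerIntegral_two_sub_neg b a hz'
  have hc : 1 - z⁻¹ / (1 + z⁻¹) = z / (1 + z) := by field_simp; ring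
  have hrefl : ∫ p in (0 : ℝ)..(z⁻¹ / (1 + z⁻¹)), (p : ℂ) ^ (a - 2) * (1 - (p : ℂ)) ^ (b - 2) =
      ∫ p in (z / (1 + z))..1, (p : ℂ) ^ (b - 2) * (1 - (p : ℂ)) ^ (a - 2) := by
    have := intervalIntegral.integral_comp_sub_left (a := 0) (b := z⁻¹ / (1 + z⁻¹))
      (fun p : ℝ => (p : ℂ) ^ (b - 2) * (1 - (p : ℂ)) ^ (a - 2)) 1
    rw [hc, sub_zero] at this
    rw [← this]
    congr 1 with p
    push_cast
    rw [sub_sub_cancel, mul_comm]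
  have hcoef : ((z⁻¹ : ℝ) : ℂ) ^ (a - 1) * ((1 + z⁻¹ : ℝ) : ℂ) ^ (3 - b - a) =
      (z : ℂ) ^ (b - 1) * ((1 + z : ℝ) : ℂ) ^ (3 - a - b) * (z : ℂ)⁻¹ := by
    have e1 : 1 + z⁻¹ = (1 + z) / z := by field_simp; ring
    have e2 : (z : ℂ)⁻¹ = Complex.exp (-Real.log z) := by
      rw [Complex.exp_neg, ← Complex.ofReal_exp, Real.exp_log hz]
    rw [e1, e2, ofReal_cpow_eq_exp hz', ofReal_cpow_eq_exp (div_pos hq hz), ofReal_cpow_eq_exp hz,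
      ofReal_cpow_eq_exp hq, Real.log_div hq.ne' hz.ne', Real.log_inv]
    simp only [← Complex.exp_add]
    congr 1
    push_cast
    ring
  have hint : IntervalIntegrable (fun p : ℝ => (p : ℂ) ^ (b - 2) * (1 - (p : ℂ)) ^ (a - 2))
      volume 0 1 := by
    have := Complex.betaIntegral_convergent (u := b - 1) (v := a - 1) (by simp; linarith)
      (by simp; linarith)
    rwa [show b - 1 - 1 = b - 2 by ring, show a - 1 - 1 = a - 2 by ring] at this
  have hmem : z / (1 + z) ∈ Set.uIcc (0 : ℝ) 1 := by
    rw [Set.uIcc_of_le zero_le_one]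
    exact ⟨by positivity, (div_le_one hq).2 (by linarith)⟩
  have hadd := intervalIntegral.integral_add_adjacent_intervals
    (hint.mono_set (Set.uIcc_subset_uIcc_left hmem))
    (hint.mono_set (Set.uIcc_subset_uIcc_right hmem))
  rw [hcoef, hrefl] at h2
  rw [Complex.betaIntegral, show b - 1 - 1 = b - 2 by ring, show a - 1 - 1 = a - 2 by ring,
    ← hadd]
  linear_combination -(a - 1) * h1 - (b - 1) * h2

/-- `F(1, 2 - a; b; -z) / (Γ(a - 1) Γ(b))`. -/
noncomputable def regHyp (a b : ℂ) (z : ℝ) : ℂ :=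
  hypergeom {1, 2 - a} {b} (-(z : ℂ)) / (Complex.Gamma (a - 1) * Complex.Gamma b)

theorem Gamma_eq_sub_one_mul {s : ℂ} (hs : s ≠ 1) :
    Complex.Gamma s = (s - 1) * Complex.Gamma (s - 1) := by
  have := Complex.Gamma_add_one (s - 1) (sub_ne_zero.2 hs)
  rwa [sub_add_cancel] at this

theorem inv_Gamma_sub_one (s : ℂ) :
    (Complex.Gamma (s - 1))⁻¹ = (s - 1) * (Complex.Gamma s)⁻¹ := by
  have := Complex.one_div_Gamma_eq_self_mul_one_div_Gamma_add_one (s - 1)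
  rwa [sub_add_cancel] at this

theorem regHyp_add_of_two_lt {a b : ℂ} (ha : 2 < a.re) (hb : 2 < b.re) {z : ℝ} (hz : 0 < z) :
    regHyp a b z + (z : ℂ)⁻¹ * regHyp b a z⁻¹ =
      (z : ℂ) ^ (1 - b) * ((1 + z : ℝ) : ℂ) ^ (a + b - 3) * (Complex.Gamma (a + b - 2))⁻¹ := by
  have hq : 0 < 1 + z := by linarith
  have key := betaIntegral_eq_add_eulerIntegral ha hb hz
  have hB := Complex.Gamma_mul_Gamma_eq_betaIntegral (s := b - 1) (t := a - 1)
    (by simp; linarith) (by simp; linarith)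
  have hga : Complex.Gamma a ≠ 0 := Complex.Gamma_ne_zero_of_re_pos (by linarith)
  have hgb : Complex.Gamma b ≠ 0 := Complex.Gamma_ne_zero_of_re_pos (by linarith)
  have hgab : Complex.Gamma (a + b - 2) ≠ 0 :=
    Complex.Gamma_ne_zero_of_re_pos (by simp; linarith)
  have ha1 : a ≠ 1 := fun h => by norm_num [h] at ha
  have hb1 : b ≠ 1 := fun h => by norm_num [h] at hb
  have hpow : (z : ℂ) ^ (1 - b) * ((1 + z : ℝ) : ℂ) ^ (a + b - 3) *
      ((z : ℂ) ^ (b - 1) * ((1 + z : ℝ) : ℂ) ^ (3 - a - b)) = 1 := by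
    simp only [ofReal_cpow_eq_exp hz, ofReal_cpow_eq_exp hq, ← Complex.exp_add]
    rw [← Complex.exp_zero]
    congr 1
    ring
  rw [show b - 1 + (a - 1) = a + b - 2 by ring] at hB
  have hB' : (a - 1) * (b - 1) * Complex.betaIntegral (b - 1) (a - 1) =
      Complex.Gamma a * Complex.Gamma b * (Complex.Gamma (a + b - 2))⁻¹ := by
    rw [← div_eq_mul_inv, eq_div_iff hgab, Gamma_eq_sub_one_mul ha1, Gamma_eq_sub_one_mul hb1]
    linear_combination -(a - 1) * (b - 1) * hB
  rw [hB'] at key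
  rw [regHyp, regHyp, hypergeom_one_eq_eulerIntegral hb (neg_ofReal_mem_cutPlane hz),
    hypergeom_one_eq_eulerIntegral ha (neg_ofReal_mem_cutPlane (inv_pos.2 hz)), div_eq_mul_inv,
    div_eq_mul_inv, mul_inv, mul_inv, inv_Gamma_sub_one, inv_Gamma_sub_one]
  have hgi : (Complex.Gamma (a + b - 2))⁻¹ = (Complex.Gamma a)⁻¹ * (Complex.Gamma b)⁻¹ *
      (Complex.Gamma a * Complex.Gamma b * (Complex.Gamma (a + b - 2))⁻¹) := by
    field_simp
  rw [hgi, key]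
  linear_combination (-(Complex.Gamma a)⁻¹ * (Complex.Gamma b)⁻¹ *
    ((a - 1) * eulerIntegral (2 - a) b (-z) +
          (z : ℂ)⁻¹ * ((b - 1) * eulerIntegral (2 - b) a (-((z⁻¹ : ℝ) : ℂ))))) * hpow

theorem one_add_mul_regHyp_add {a b : ℂ} (ha : ∀ m : ℕ, a ≠ -(m : ℂ))
    (hb : ∀ m : ℕ, b ≠ -(m : ℂ)) {z : ℝ} (hz : 0 < z) :
    (1 + z : ℂ) * (regHyp a b z + (z : ℂ)⁻¹ * regHyp b a z⁻¹) =
      (a + b - 2) * z * (regHyp a (b + 1) z + (z : ℂ)⁻¹ * regHyp (b + 1) a z⁻¹) := by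
  have hz0 : (z : ℂ) ≠ 0 := by exact_mod_cast hz.ne'
  have ha0 : a ≠ 0 := by simpa using ha 0
  have hb0 : b ≠ 0 := by simpa using hb 0
  have hw := neg_ofReal_mem_cutPlane hz
  have hw' := neg_ofReal_mem_cutPlane (inv_pos.2 hz)
  have h1 := one_sub_mul_hypergeom_one (β := 2 - a) hb hw
  have h2 := one_sub_mul_hypergeom_one (β := 2 - b) ha hw'
  have h3 := hypergeom_one_eq_raise (β := 2 - (b + 1)) (γ := a) hw'
  rw [show 2 - (b + 1) + 1 = 2 - b by ring] at h3
  simp only [regHyp, div_eq_mul_inv, mul_inv, inv_Gamma_sub_one, Complex.Gamma_add_one b hb0]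
  generalize hypergeom {1, 2 - a} {b} (-(z : ℂ)) = A at *
  generalize hypergeom {1, 2 - a} {b + 1} (-(z : ℂ)) = B at *
  generalize hypergeom {1, 2 - b} {a} (-((z⁻¹ : ℝ) : ℂ)) = C at *
  generalize hypergeom {1, 2 - (b + 1)} {a} (-((z⁻¹ : ℝ) : ℂ)) = D at *
  generalize hypergeom {1, 2 - b} {a + 1} (-((z⁻¹ : ℝ) : ℂ)) = E at *
  rw [add_sub_cancel_right]
  push_cast at h2 h3
  generalize (Complex.Gamma a)⁻¹ = G
  generalize (Complex.Gamma b)⁻¹ = H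
  -- Since $(a-1)+(b-1)=a+b-2$, these weights cancel the constant terms, and they also eliminate
  -- `E`, which occurs in both `h2` and `h3`.
  linear_combination (norm := (field_simp; ring))
    G * H * ((a - 1) * h1 + (b - 1) * h2 - (a + b - 2) * h3)

/-- The connection formula of `F(1, 2 - a; b; -z)` with its companion at `1 / z`. -/
def ConnectionFormula (a b : ℂ) : Prop :=
  ∀ z : ℝ, 0 < z → regHyp a b z + (z : ℂ)⁻¹ * regHyp b a z⁻¹ =
    (z : ℂ) ^ (1 - b) * ((1 + z : ℝ) : ℂ) ^ (a + b - 3) * (Complex.Gamma (a + b - 2))⁻¹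

/-- Evaluate at $1/z$ and divide by $z$. -/
theorem ConnectionFormula.symm {a b : ℂ} (h : ConnectionFormula a b) : ConnectionFormula b a := by
  intro z hz
  have hq : 0 < 1 + z := by linarith
  have hz' : 0 < z⁻¹ := inv_pos.2 hz
  have hz0 : (z : ℂ) ≠ 0 := by exact_mod_cast hz.ne'
  have key := h z⁻¹ hz'
  have hcoef : ((z⁻¹ : ℝ) : ℂ) ^ (1 - b) * ((1 + z⁻¹ : ℝ) : ℂ) ^ (a + b - 3) =
      (z : ℂ) ^ (1 - a) * ((1 + z : ℝ) : ℂ) ^ (b + a - 3) * z := by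
    have e1 : 1 + z⁻¹ = (1 + z) / z := by field_simp; ring
    have e2 : (z : ℂ) = Complex.exp (Real.log z) := by
      rw [← Complex.ofReal_exp, Real.exp_log hz]
    nth_rewrite 2 [e2]
    rw [e1, ofReal_cpow_eq_exp hz', ofReal_cpow_eq_exp (div_pos hq hz), ofReal_cpow_eq_exp hz,
      ofReal_cpow_eq_exp hq, Real.log_div hq.ne' hz.ne', Real.log_inv]
    simp only [← Complex.exp_add]
    congr 1
    push_cast
    ring
  rw [hcoef, inv_inv] at key
  push_cast at key
  rw [inv_inv] at key
  rw [show b + a - 2 = a + b - 2 by ring]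
  push_cast
  linear_combination (norm := (field_simp; ring)) (z : ℂ)⁻¹ * key

/-- The right side satisfies the recursion of `one_add_mul_regHyp_add` too, and $1+z\ne0$ can be
cancelled. -/
theorem ConnectionFormula.of_add_one {a b : ℂ} (ha : ∀ m : ℕ, a ≠ -(m : ℂ))
    (hb : ∀ m : ℕ, b ≠ -(m : ℂ)) (h : ConnectionFormula a (b + 1)) : ConnectionFormula a b := by
  intro z hz
  have hz0 : (z : ℂ) ≠ 0 := by exact_mod_cast hz.ne'
  have hq : 0 < 1 + z := by linarith
  have hq0 : ((1 + z : ℝ) : ℂ) ≠ 0 := by exact_mod_cast hq.ne'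
  have h1 := one_add_mul_regHyp_add ha hb hz
  have e1 : (z : ℂ) ^ (1 - b) = z ^ (1 - (b + 1)) * z := by
    rw [show 1 - b = 1 - (b + 1) + 1 by ring, Complex.cpow_add _ _ hz0, Complex.cpow_one]
  have e2 : ((1 + z : ℝ) : ℂ) ^ (a + (b + 1) - 3) =
      ((1 + z : ℝ) : ℂ) ^ (a + b - 3) * ((1 + z : ℝ) : ℂ) := by
    rw [show a + (b + 1) - 3 = a + b - 3 + 1 by ring, Complex.cpow_add _ _ hq0, Complex.cpow_one]
  have e3 : (Complex.Gamma (a + b - 2))⁻¹ =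
      (a + b - 2) * (Complex.Gamma (a + (b + 1) - 2))⁻¹ := by
    have := inv_Gamma_sub_one (a + b - 1)
    rwa [show a + b - 1 - 1 = a + b - 2 by ring, show a + b - 1 = a + (b + 1) - 2 by ring] at this
  rw [h z hz, e2] at h1
  rw [e1, e3]
  refine mul_left_cancel₀ hq0 ?_
  push_cast at h1 ⊢
  rw [h1]
  ring

theorem add_one_ne_neg_natCast {s : ℂ} (hs : ∀ m : ℕ, s ≠ -(m : ℂ)) (m : ℕ) : s + 1 ≠ -(m : ℂ) :=
  fun h => hs (m + 1) (by push_cast; linear_combination h)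

theorem connectionFormula_of_two_lt_re {a b : ℂ} (ha : ∀ m : ℕ, a ≠ -(m : ℂ))
    (hb : ∀ m : ℕ, b ≠ -(m : ℂ)) (hre : 2 < a.re) : ConnectionFormula a b := by
  obtain ⟨n, hn⟩ := exists_nat_gt (2 - b.re)
  induction n generalizing b with
  | zero => exact fun z hz => regHyp_add_of_two_lt hre (by simpa using hn) hz
  | succ n ih =>
    refine .of_add_one ha hb (ih (add_one_ne_neg_natCast hb) ?_)
    push_cast at hn
    simp
    linarith

theorem connectionFormula {a b : ℂ} (ha : ∀ m : ℕ, a ≠ -(m : ℂ))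
    (hb : ∀ m : ℕ, b ≠ -(m : ℂ)) : ConnectionFormula a b := by
  obtain ⟨n, hn⟩ := exists_nat_gt (2 - b.re)
  induction n generalizing b with
  -- Here $\operatorname{Re}b>2$, so the preceding lemma applies with the roles of $a$ and $b$
  -- exchanged.
  | zero => exact (connectionFormula_of_two_lt_re hb ha (by simpa using hn)).symm
  | succ n ih =>
    refine .of_add_one ha hb (ih (add_one_ne_neg_natCast hb) ?_)
    push_cast at hn
    simp
    linarith

/-! ### The reflection formula and the moments -/

/-- Uses $(\alpha_1-1)/\Gamma(\alpha_1)=1/\Gamma(\alpha_1-1)$, valid also at $\alpha_1=1$ because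
`Complex.Gamma 0 = 0`. Both terms have the same parameter sum $\alpha_1+\alpha_2$. -/
theorem estimator_eq_regHyp {α₁ α₂ : ℝ} (hα₁ : 0 < α₁) (hα₂ : 0 < α₂) (ν : ℂ)
    (y₁ y₂ : ℝ) :
    estimator ν y₁ y₂ α₁ α₂ = Complex.Gamma α₁ * Complex.Gamma α₂ / (α₁ * y₁) *
      (regHyp α₁ α₂ (α₂ * y₂ / (α₁ * y₁)) -
        ((α₂ * y₂ / (α₁ * y₁) : ℝ) : ℂ) ^ ν *
          regHyp (α₁ - ν) (α₂ + ν) (α₂ * y₂ / (α₁ * y₁))) := by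
  have hg1 : Complex.Gamma α₁ ≠ 0 := Complex.Gamma_ne_zero_of_re_pos (by simpa using hα₁)
  have hg2 : Complex.Gamma α₂ ≠ 0 := Complex.Gamma_ne_zero_of_re_pos (by simpa using hα₂)
  have e : (α₂ * y₂ / (α₁ * y₁) : ℂ) = ((α₂ * y₂ / (α₁ * y₁) : ℝ) : ℂ) := by push_cast; rfl
  rw [estimator, e, regHyp, regHyp, poch, poch, show 2 - (α₁ - ν) = 2 - (α₁ : ℂ) + ν by ring,
    show α₁ + (-ν - 1) = (α₁ : ℂ) - ν - 1 by ring]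
  simp only [div_eq_mul_inv, mul_inv, inv_inv, inv_Gamma_sub_one (α₁ : ℂ)]
  field_simp

theorem estimator_reflection {α₁ α₂ : ℝ} (hα₁ : 0 < α₁) (hα₂ : 0 < α₂) {ν : ℂ}
    (hν₂ : ∀ m : ℕ, (α₂ : ℂ) + ν ≠ -(m : ℂ)) (hν₁ : ∀ m : ℕ, (α₁ : ℂ) - ν ≠ -(m : ℂ))
    {y₁ y₂ : ℝ} (hy₁ : 0 < y₁) (hy₂ : 0 < y₂) :
    estimator ν y₁ y₂ α₁ α₂ = -estimator (-ν) y₂ y₁ α₂ α₁ := by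
  have ofReal_ne : ∀ {α : ℝ}, 0 < α → ∀ m : ℕ, (α : ℂ) ≠ -(m : ℂ) := fun {α} hα m h => by
    have h' : α = -(m : ℝ) := by exact_mod_cast h
    have : (0 : ℝ) ≤ m := m.cast_nonneg
    linarith
  rw [estimator_eq_regHyp hα₁ hα₂, estimator_eq_regHyp hα₂ hα₁]
  have hinv : α₁ * y₁ / (α₂ * y₂) = (α₂ * y₂ / (α₁ * y₁))⁻¹ := (inv_div _ _).symm
  rw [hinv]
  have hz : 0 < α₂ * y₂ / (α₁ * y₁) := by positivity
  have hzy : (α₂ * y₂ : ℂ) = (α₁ * y₁) * ((α₂ * y₂ / (α₁ * y₁) : ℝ) : ℂ) := by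
    have h1 : (α₁ : ℂ) ≠ 0 := by exact_mod_cast hα₁.ne'
    have h2 : (y₁ : ℂ) ≠ 0 := by exact_mod_cast hy₁.ne'
    push_cast
    field_simp
  rw [hzy]
  set z : ℝ := α₂ * y₂ / (α₁ * y₁)
  have hz0 : (z : ℂ) ≠ 0 := by exact_mod_cast hz.ne'
  have h1 := connectionFormula (ofReal_ne hα₁) (ofReal_ne hα₂) z hz
  have h2 := connectionFormula hν₁ hν₂ z hz
  have e1 : (z : ℂ) ^ (1 - (α₂ + ν)) =
      (z : ℂ) ^ (1 - (α₂ : ℂ)) * ((z : ℂ) ^ ν)⁻¹ := by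
    rw [← Complex.cpow_neg, ← Complex.cpow_add _ _ hz0]
    congr 1
    ring
  have e2 : ((z⁻¹ : ℝ) : ℂ) ^ (-ν) = z ^ ν := by
    rw [ofReal_cpow_eq_exp (inv_pos.2 hz), ofReal_cpow_eq_exp hz, Real.log_inv]
    congr 1
    push_cast
    ring
  have hzν : (z : ℂ) ^ ν ≠ 0 := by simp [Complex.cpow_eq_zero_iff, hz0]
  rw [e1, show (α₁ : ℂ) - ν + (α₂ + ν) = α₁ + α₂ by ring] at h2
  rw [e2, sub_neg_eq_add, ← sub_eq_add_neg]
  simp only [div_eq_mul_inv, mul_inv]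
  -- In $h_1-z^\nu h_2$ the right sides cancel.
  linear_combination (norm := (field_simp; ring)) Complex.Gamma α₁ * Complex.Gamma α₂ *
    (α₁ : ℂ)⁻¹ * (y₁ : ℂ)⁻¹ * (h1 - (z : ℂ) ^ ν * h2)

theorem ae_gammaMeasure_pos (a r : ℝ) : ∀ᵐ x ∂gammaMeasure a r, 0 < x := by
  rw [gammaMeasure, ae_withDensity_iff (by unfold gammaPDF; fun_prop)]
  -- The density need not vanish at $0$, so this null point is removed separately.
  have h0 : ∀ᵐ x : ℝ, x ≠ 0 := by simp [ae_iff]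
  filter_upwards [h0] with x hx hpdf
  by_contra hneg
  exact hpdf (gammaPDF_of_neg (lt_of_le_of_ne (not_lt.1 hneg) hx))

end RecipDiff

theorem mainTheorem9 (α₁ α₂ : ℝ) (hα₁ : 0 < α₁) (hα₂ : 0 < α₂) (ν : ℂ)
    (hν₂ : ∀ m : ℕ, (α₂ : ℂ) + ν ≠ -(m : ℂ)) (hν₁ : ∀ m : ℕ, (α₁ : ℂ) - ν ≠ -(m : ℂ)) :
    (∀ y₁ y₂ : ℝ, 0 < y₁ → 0 < y₂ →
      RecipDiff.estimator ν y₁ y₂ α₁ α₂ = -RecipDiff.estimator (-ν) y₂ y₁ α₂ α₁) ∧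
    (∀ (n : ℕ) (κ₁ κ₂ : ℝ), 0 < κ₁ → 0 < κ₂ →
      (RecipDiff.HasMoment n ν κ₁ κ₂ α₁ α₂ ↔ RecipDiff.HasMoment n (-ν) κ₂ κ₁ α₂ α₁) ∧
      RecipDiff.moment n ν κ₁ κ₂ α₁ α₂ =
        (-1) ^ n * RecipDiff.moment n (-ν) κ₂ κ₁ α₂ α₁) := by
  refine ⟨fun y₁ y₂ hy₁ hy₂ => RecipDiff.estimator_reflection hα₁ hα₂ hν₂ hν₁ hy₁ hy₂, ?_⟩
  intro n κ₁ κ₂ hκ₁ hκ₂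
  have := isProbabilityMeasure_gammaMeasure hα₁ (div_pos hα₁ hκ₁)
  have := isProbabilityMeasure_gammaMeasure hα₂ (div_pos hα₂ hκ₂)
  have hae : (fun y : ℝ × ℝ => RecipDiff.estimator ν y.1 y.2 α₁ α₂ ^ n)
      =ᵐ[RecipDiff.jointLaw κ₁ κ₂ α₁ α₂]
      fun y => (-1) ^ n * RecipDiff.estimator (-ν) y.swap.1 y.swap.2 α₂ α₁ ^ n := by
    have h1 : ∀ᵐ y ∂(RecipDiff.jointLaw κ₁ κ₂ α₁ α₂), 0 < y.1 :=
      Measure.quasiMeasurePreserving_fst.ae (RecipDiff.ae_gammaMeasure_pos α₁ (α₁ / κ₁))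
    have h2 : ∀ᵐ y ∂(RecipDiff.jointLaw κ₁ κ₂ α₁ α₂), 0 < y.2 :=
      Measure.quasiMeasurePreserving_snd.ae (RecipDiff.ae_gammaMeasure_pos α₂ (α₂ / κ₂))
    filter_upwards [h1, h2] with y hy₁ hy₂
    rw [RecipDiff.estimator_reflection hα₁ hα₂ hν₂ hν₁ hy₁ hy₂, neg_pow]
    rfl
  constructor
  · rw [RecipDiff.HasMoment, integrable_congr hae, integrable_const_mul_iff (by simp)]
    exact integrable_swap_iff (f := fun y : ℝ × ℝ => RecipDiff.estimator (-ν) y.1 y.2 α₂ α₁ ^ n)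
  -- No integrability is required: without it both Bochner integrals are $0$.
  · rw [RecipDiff.moment, integral_congr_ae hae, integral_const_mul]
    congr 1
    exact integral_prod_swap (fun y : ℝ × ℝ => RecipDiff.estimator (-ν) y.1 y.2 α₂ α₁ ^ n)
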